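/- Let $W$ be a Coxeter group of type $E_8$: it is generated by a set $S$ of eight elements subject only to the relations $(ss')^{m(s,s')}=1$, where $m(s,s)=1$ and $m(s,s')=m(s',s)\in\{2,3\}$ for $s\neq s'$, and the graph on $S$ with edge set $R=\{ss' : m(s,s')=3\}$ is the Dynkin diagram $E_8$. For $s\in S$ let $\mathbf{s}$ be the matrix over the two-element field $\mathbb{F}_2$, with rows and columns indexed by $S$, whose entries are $$\mathbf{s}_{uv}=\begin{cases}1,&\text{if } u=v,\text{ or } v=s \text{ and } uv\in R,\\ 0,&\text{otherwise.}\end{cases}$$ Let $\phi: W\to \mathrm{GL}_8(\mathbb{F}_2)$ be the Vogan representation of $W$, that is, the group homomorphism with $\phi(s)=\mathbf{s}$ for all $s\in S$. Then $\operatorname{Ker}\phi$ has order $2$, and $\operatorname{Ker}\phi=Z(W)$, the center of $W$. -/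

import Mathlib

/-- A Coxeter matrix is simply laced if `m(s, s') ∈ {2, 3}` for all distinct `s`, `s'`. -/
def CoxeterMatrix.IsSimplyLaced {S : Type*} (M : CoxeterMatrix S) : Prop :=
  ∀ s t : S, s ≠ t → M s t = 2 ∨ M s t = 3

/-- The Coxeter graph of a (simply laced) Coxeter matrix: the vertices are the generators, and
`s`, `t` are joined by an edge exactly when `m(s, t) = 3`. -/
def CoxeterMatrix.coxeterGraph {S : Type*} (M : CoxeterMatrix S) : SimpleGraph S where
  Adj s t := M s t = 3
  symm := ⟨fun s t h => by rw [M.symmetric t s]; exact h⟩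
  loopless := ⟨fun s h => by simp at h⟩

instance {S : Type*} (M : CoxeterMatrix S) : DecidableRel M.coxeterGraph.Adj :=
  fun s t => inferInstanceAs (Decidable (M s t = 3))

/-- A simply laced Coxeter matrix is of type `E₈` if its Coxeter graph is isomorphic to the
Dynkin diagram `E₈`. -/
def CoxeterMatrix.IsTypeE8 {S : Type*} (M : CoxeterMatrix S) : Prop :=
  M.IsSimplyLaced ∧ Nonempty (M.coxeterGraph ≃g CoxeterMatrix.E₈.coxeterGraph)

/-- The matrix over the field with two elements of the move of the flipping puzzle on the graph `G`
which selects the vertex `s`: its `(u, v)` entry is `1` if `u = v`, or if `v = s` and `uv` is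
an edge, and it is `0` otherwise. -/
def flipMatrix {S : Type*} [DecidableEq S] (G : SimpleGraph S) [DecidableRel G.Adj] (s : S) :
    Matrix S S (ZMod 2) :=
  Matrix.of fun u v => if u = v ∨ (v = s ∧ G.Adj u v) then 1 else 0

/-- The nilpotent part of a move. -/
def flipNilp {S : Type*} [DecidableEq S] (G : SimpleGraph S) [DecidableRel G.Adj] (s : S) :
    Matrix S S (ZMod 2) :=
  Matrix.vecMulVec (fun u => if G.Adj u s then 1 else 0) (Pi.single s 1)

theorem flipMatrix_eq {S : Type*} [DecidableEq S] (G : SimpleGraph S) [DecidableRel G.Adj]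
    (s : S) : flipMatrix G s = 1 + flipNilp G s := by
  ext u v
  by_cases huv : u = v
  · subst huv
    by_cases hus : u = s
    · subst hus
      simp [flipMatrix, flipNilp, Matrix.vecMulVec_apply]
    · simp [flipMatrix, flipNilp, Matrix.vecMulVec_apply, hus]
  · by_cases hvs : v = s
    · subst hvs
      simp [flipMatrix, flipNilp, Matrix.vecMulVec_apply, huv]
    · simp [flipMatrix, flipNilp, Matrix.vecMulVec_apply, huv, hvs]

theorem flipNilp_mul {S : Type*} [Fintype S] [DecidableEq S] (G : SimpleGraph S)
    [DecidableRel G.Adj] (s t : S) :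
    flipNilp G s * flipNilp G t =
      if G.Adj s t then
        Matrix.vecMulVec (fun u => if G.Adj u s then 1 else 0) (Pi.single t 1) else 0 := by
  unfold flipNilp
  rw [Matrix.vecMulVec_mul_vecMulVec]
  split_ifs with h <;> simp [single_dotProduct, h]

theorem flipNilp_mul_eq_zero {S : Type*} [Fintype S] [DecidableEq S] (G : SimpleGraph S)
    [DecidableRel G.Adj] {s t : S} (h : ¬ G.Adj s t) : flipNilp G s * flipNilp G t = 0 := by
  rw [flipNilp_mul, if_neg h]

theorem flipNilp_mul_mul {S : Type*} [Fintype S] [DecidableEq S] (G : SimpleGraph S)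
    [DecidableRel G.Adj] {s t : S} (h : G.Adj s t) :
    flipNilp G s * flipNilp G t * flipNilp G s = flipNilp G s := by
  rw [flipNilp_mul, if_pos h]
  unfold flipNilp
  rw [Matrix.vecMulVec_mul_vecMulVec]
  simp [single_dotProduct, h.symm]

theorem flipMatrix_add_self {S : Type*} (A : Matrix S S (ZMod 2)) : A + A = 0 := by
  ext u v
  exact CharTwo.add_self_eq_zero (A u v)

theorem flipMatrix_mul_self {S : Type*} [Fintype S] [DecidableEq S] (G : SimpleGraph S)
    [DecidableRel G.Adj] (s : S) : flipMatrix G s * flipMatrix G s = 1 := by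
  have h0 := flipNilp_mul_eq_zero G (G.irrefl (v := s))
  have h2 := flipMatrix_add_self (flipNilp G s)
  rw [flipMatrix_eq]
  calc _ = 1 + (flipNilp G s + flipNilp G s) + flipNilp G s * flipNilp G s := by noncomm_ring
    _ = 1 := by rw [h0, h2]; simp

theorem flipMatrix_sq_of_not_adj {S : Type*} [Fintype S] [DecidableEq S] (G : SimpleGraph S)
    [DecidableRel G.Adj] {s t : S} (h : ¬ G.Adj s t) :
    (flipMatrix G s * flipMatrix G t) ^ 2 = 1 := by
  have hs := flipMatrix_mul_self G s
  have ht := flipMatrix_mul_self G t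
  have hc : flipMatrix G s * flipMatrix G t = flipMatrix G t * flipMatrix G s := by
    have h1 := flipNilp_mul_eq_zero G h
    have h2 := flipNilp_mul_eq_zero G (fun h' => h h'.symm)
    rw [flipMatrix_eq, flipMatrix_eq]
    calc _ = 1 + flipNilp G s + flipNilp G t + flipNilp G s * flipNilp G t := by noncomm_ring
      _ = 1 + flipNilp G s + flipNilp G t + flipNilp G t * flipNilp G s := by rw [h1, h2]
      _ = _ := by noncomm_ring
  calc (flipMatrix G s * flipMatrix G t) ^ 2
      = flipMatrix G s * (flipMatrix G t * flipMatrix G s) * flipMatrix G t := by noncomm_ring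
    _ = (flipMatrix G s * flipMatrix G s) * (flipMatrix G t * flipMatrix G t) := by
        rw [← hc]; noncomm_ring
    _ = 1 := by rw [hs, ht, one_mul]

theorem flipMatrix_mul_mul {S : Type*} [Fintype S] [DecidableEq S] (G : SimpleGraph S)
    [DecidableRel G.Adj] {s t : S} (h : G.Adj s t) :
    flipMatrix G s * flipMatrix G t * flipMatrix G s =
      1 + flipNilp G t + flipNilp G s * flipNilp G t + flipNilp G t * flipNilp G s +
        flipNilp G s := by
  have h0 := flipNilp_mul_eq_zero G (G.irrefl (v := s))
  have h1 := flipNilp_mul_mul G h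
  have h2 := flipMatrix_add_self (flipNilp G s)
  rw [flipMatrix_eq, flipMatrix_eq]
  calc _ = 1 + flipNilp G t + flipNilp G s * flipNilp G t + flipNilp G t * flipNilp G s
        + (flipNilp G s + flipNilp G s) + flipNilp G s * flipNilp G s
        + flipNilp G s * flipNilp G t * flipNilp G s := by noncomm_ring
    _ = _ := by rw [h0, h1, h2]; simp

theorem flipMatrix_cube_of_adj {S : Type*} [Fintype S] [DecidableEq S] (G : SimpleGraph S)
    [DecidableRel G.Adj] {s t : S} (h : G.Adj s t) :
    (flipMatrix G s * flipMatrix G t) ^ 3 = 1 := by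
  have hs := flipMatrix_mul_self G s
  have ht := flipMatrix_mul_self G t
  have hb : flipMatrix G s * flipMatrix G t * flipMatrix G s =
      flipMatrix G t * flipMatrix G s * flipMatrix G t := by
    rw [flipMatrix_mul_mul G h, flipMatrix_mul_mul G h.symm]
    abel
  calc (flipMatrix G s * flipMatrix G t) ^ 3
      = (flipMatrix G s * flipMatrix G t * flipMatrix G s) *
          (flipMatrix G t * flipMatrix G s * flipMatrix G t) := by noncomm_ring
    _ = flipMatrix G t * (flipMatrix G s * (flipMatrix G t * flipMatrix G t) * flipMatrix G s) *
          flipMatrix G t := by rw [hb]; noncomm_ring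
    _ = 1 := by rw [ht, mul_one, hs, mul_one, ht]

/-- The move which selects the vertex `s`, as an element of the general linear group over the
field with two elements. -/
def flipMove {S : Type*} [Fintype S] [DecidableEq S] (G : SimpleGraph S) [DecidableRel G.Adj]
    (s : S) : GL S (ZMod 2) where
  val := flipMatrix G s
  inv := flipMatrix G s
  val_inv := flipMatrix_mul_self G s
  inv_val := flipMatrix_mul_self G s

theorem flipMove_isLiftable {S : Type*} [Fintype S] [DecidableEq S] {M : CoxeterMatrix S}
    (hM : M.IsSimplyLaced) : M.IsLiftable (flipMove M.coxeterGraph) := by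
  intro s t
  apply Units.ext
  simp only [Units.val_pow_eq_pow_val, Units.val_mul, Units.val_one]
  change (flipMatrix M.coxeterGraph s * flipMatrix M.coxeterGraph t) ^ (M s t) = 1
  by_cases hst : s = t
  · subst hst
    rw [flipMatrix_mul_self, one_pow]
  · rcases hM s t hst with h | h
    · rw [h]
      exact flipMatrix_sq_of_not_adj _ (fun h' => by
        have h3 : M s t = 3 := h'
        omega)
    · rw [h]
      exact flipMatrix_cube_of_adj _ h

/-- The Vogan representation of a simply laced Coxeter group `W`: the homomorphism from `W` to the
general linear group over the field with two elements which sends each generator `s` to the move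
of the flipping puzzle on the Coxeter graph which selects `s`. -/
def voganRep {S : Type*} [Fintype S] [DecidableEq S] {M : CoxeterMatrix S} {W : Type*} [Group W]
    (cs : CoxeterSystem M W) (hM : M.IsSimplyLaced) : W →* GL S (ZMod 2) :=
  cs.lift ⟨flipMove M.coxeterGraph, flipMove_isLiftable hM⟩

theorem voganRep_simple {S : Type*} [Fintype S] [DecidableEq S] {M : CoxeterMatrix S}
    {W : Type*} [Group W] (cs : CoxeterSystem M W) (hM : M.IsSimplyLaced) (s : S) :
    voganRep cs hM (cs.simple s) = flipMove M.coxeterGraph s :=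
  cs.lift_apply_simple (flipMove_isLiftable hM) s

/-! Let `W` act on the root lattice by its geometric representation, which is faithful. Modulo 2
this action is dual to the Vogan representation, so the kernel consists of the `w` acting trivially
on the lattice mod 2 (`mem_ker_voganRep_iff`).

Both the kernel and the center consist of elements sending every simple root α to ±α. In the kernel,
wα = α + 2z, and the positive definite integral form q with q(α) = 1 forces z = 0 or z = -α. In the
center, wα lies on the line of α and has the same norm. The diagram is connected, so one sign serves
for all simple roots and w acts as 1 or -1. Conversely, -1 is the 15th power of a Coxeter element;
it is central and trivial mod 2. By faithfulness both subgroups are the same pair. -/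

/-- The functional `x ↦ ⟨x, α_s⟩` on the root lattice of a simply laced Coxeter matrix, in the
coordinates given by the simple roots. -/
def CoxeterMatrix.simpleCoroot {S : Type*} [Fintype S] [DecidableEq S] (M : CoxeterMatrix S)
    (s : S) : (S → ℤ) →ₗ[ℤ] ℤ :=
  ∑ t, (if t = s then 2 else if M s t = 3 then -1 else 0 : ℤ) • LinearMap.proj t

/-- The simple reflection `x ↦ x - ⟨x, α_s⟩ α_s` of the root lattice of a simply laced Coxeter
matrix. -/
def CoxeterMatrix.simpleReflection {S : Type*} [Fintype S] [DecidableEq S] (M : CoxeterMatrix S)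
    (s : S) : Module.End ℤ (S → ℤ) :=
  1 - (M.simpleCoroot s).smulRight (Pi.single s 1)

/-! ### Simple reflections satisfy the Coxeter relations -/

namespace CoxeterMatrix

variable {S : Type*} [Fintype S] [DecidableEq S] (M : CoxeterMatrix S)

theorem simpleCoroot_apply (s : S) (x : S → ℤ) :
    M.simpleCoroot s x = ∑ t, (if t = s then 2 else if M s t = 3 then -1 else 0 : ℤ) * x t := by
  simp only [simpleCoroot, LinearMap.sum_apply, LinearMap.smul_apply, LinearMap.proj_apply,
    smul_eq_mul]

theorem simpleReflection_apply (s : S) (x : S → ℤ) :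
    M.simpleReflection s x = x - M.simpleCoroot s x • Pi.single s 1 := by
  simp [simpleReflection]

theorem simpleCoroot_single (s t : S) :
    M.simpleCoroot s (Pi.single t 1) = if t = s then 2 else if M s t = 3 then -1 else 0 := by
  simp [simpleCoroot_apply, Pi.single_apply]

theorem simpleCoroot_single_self (s : S) : M.simpleCoroot s (Pi.single s 1) = 2 := by
  simp [simpleCoroot_single]

variable {M}

theorem simpleCoroot_single_of_eq_three {s t : S} (h : M s t = 3) :
    M.simpleCoroot s (Pi.single t 1) = -1 := by
  have : t ≠ s := by rintro rfl; simp at h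
  simp [simpleCoroot_single, h, this]

theorem simpleCoroot_single_of_eq_two {s t : S} (h : M s t = 2) :
    M.simpleCoroot s (Pi.single t 1) = 0 := by
  have : t ≠ s := by rintro rfl; simp at h
  simp [simpleCoroot_single, h, this]

theorem simpleReflection_mul_self (s : S) :
    M.simpleReflection s * M.simpleReflection s = 1 := by
  refine LinearMap.ext fun x => ?_
  simp only [Module.End.mul_apply, simpleReflection_apply, map_sub, map_smul,
    simpleCoroot_single_self, Module.End.one_apply]
  module

theorem isLiftable_simpleReflection (hM : M.IsSimplyLaced) :
    M.IsLiftable M.simpleReflection := by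
  intro s t
  by_cases hst : s = t
  · subst hst
    rw [simpleReflection_mul_self, one_pow]
  refine LinearMap.ext fun x => ?_
  rcases hM s t hst with h | h <;> rw [h]
  · simp only [pow_succ, pow_zero, one_mul, Module.End.mul_apply, simpleReflection_apply, map_sub,
      map_smul, simpleCoroot_single_self, simpleCoroot_single_of_eq_two h,
      simpleCoroot_single_of_eq_two ((M.symmetric t s).trans h), Module.End.one_apply]
    module
  · simp only [pow_succ, pow_zero, one_mul, Module.End.mul_apply, simpleReflection_apply, map_sub,
      map_smul, simpleCoroot_single_self, simpleCoroot_single_of_eq_three h,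
      simpleCoroot_single_of_eq_three ((M.symmetric t s).trans h),
      Module.End.one_apply]
    module

end CoxeterMatrix

/-! ### The geometric representation and its faithfulness -/

namespace CoxeterSystem

theorem simple_mul_simple_comm {S : Type*} {M : CoxeterMatrix S} {W : Type*} [Group W]
    (cs : CoxeterSystem M W) {s t : S} (h : M s t = 2) :
    cs.simple s * cs.simple t = cs.simple t * cs.simple s := by
  have := cs.simple_mul_simple_pow s t
  rw [h, pow_two] at this
  rw [eq_inv_of_mul_eq_one_left this, mul_inv_rev, inv_simple, inv_simple]

theorem simple_braid {S : Type*} {M : CoxeterMatrix S} {W : Type*} [Group W]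
    (cs : CoxeterSystem M W) {s t : S} (h : M s t = 3) :
    cs.simple s * cs.simple t * cs.simple s = cs.simple t * cs.simple s * cs.simple t := by
  have := cs.simple_mul_simple_pow s t
  rw [h, pow_three] at this
  have h2 : (cs.simple s * cs.simple t * cs.simple s) *
      (cs.simple t * cs.simple s * cs.simple t) = 1 := by
    rw [← this]; group
  rw [eq_inv_of_mul_eq_one_left h2]
  simp [mul_assoc]

variable {S : Type*} [Fintype S] [DecidableEq S] {M : CoxeterMatrix S} {W : Type*} [Group W]
  (cs : CoxeterSystem M W) (hM : M.IsSimplyLaced)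

/-- The geometric representation of a simply laced Coxeter group on its root lattice. -/
def geomRep : W →* Module.End ℤ (S → ℤ) :=
  cs.lift ⟨M.simpleReflection, CoxeterMatrix.isLiftable_simpleReflection hM⟩

theorem geomRep_simple (s : S) : cs.geomRep hM (cs.simple s) = M.simpleReflection s :=
  cs.lift_apply_simple (CoxeterMatrix.isLiftable_simpleReflection hM) s

theorem geomRep_mul_simple_apply (w : W) (s : S) (x : S → ℤ) :
    cs.geomRep hM (w * cs.simple s) x =
      cs.geomRep hM w x - M.simpleCoroot s x • cs.geomRep hM w (Pi.single s 1) := by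
  rw [map_mul, Module.End.mul_apply, geomRep_simple, CoxeterMatrix.simpleReflection_apply,
    map_sub, map_smul]

theorem geomRep_mul_simple_single_self (w : W) (s : S) :
    cs.geomRep hM (w * cs.simple s) (Pi.single s 1) = -cs.geomRep hM w (Pi.single s 1) := by
  rw [geomRep_mul_simple_apply, CoxeterMatrix.simpleCoroot_single_self]
  module

/-- If `ℓ(ws) > ℓ(w)` then `w` sends the simple root `α_s` to a positive root. -/
theorem geomRep_single_nonneg (w : W) (s : S) (h : ¬ cs.IsRightDescent w s) :
    0 ≤ cs.geomRep hM w (Pi.single s 1) := by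
  induction hn : cs.length w using Nat.strong_induction_on generalizing w s with
  | _ n ih =>
  subst hn
  by_cases hw : w = 1
  · subst hw
    simp
  obtain ⟨t, ht⟩ := cs.exists_rightDescent_of_ne_one hw
  have hts : s ≠ t := by rintro rfl; exact h ht
  obtain ⟨v, rfl⟩ : ∃ v, w = v * cs.simple t := ⟨w * cs.simple t, by simp⟩
  rw [cs.not_isRightDescent_iff] at h
  rw [isRightDescent_iff, simple_mul_simple_cancel_right] at ht
  -- Now w = vt with v shorter. If m = 2, then wα_s = vα_s; if m = 3, then wα_s = vα_s + vα_t.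
  rcases hM s t hts with hm | hm
  · rw [geomRep_mul_simple_apply,
      CoxeterMatrix.simpleCoroot_single_of_eq_two ((M.symmetric t s).trans hm), zero_smul, sub_zero]
    refine ih _ (by omega) v s (fun hd => ?_) rfl
    rw [isRightDescent_iff] at hd
    rw [mul_assoc, ← cs.simple_mul_simple_comm hm, ← mul_assoc] at h
    have := cs.length_mul_le (v * cs.simple s) (cs.simple t)
    rw [length_simple] at this
    omega
  · rw [geomRep_mul_simple_apply,
      CoxeterMatrix.simpleCoroot_single_of_eq_three ((M.symmetric t s).trans hm), neg_one_smul,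
      sub_neg_eq_add]
    -- If v = us with u shorter, then v(α_s + α_t) = uα_t. A descent t of u would give ws = (ut)(st)
    -- length at most ℓ(u) + 1, whereas ℓ(ws) = ℓ(u) + 3.
    by_cases hd : cs.IsRightDescent v s
    · obtain ⟨u, rfl⟩ : ∃ u, v = u * cs.simple s := ⟨v * cs.simple s, by simp⟩
      rw [isRightDescent_iff, simple_mul_simple_cancel_right] at hd
      rw [geomRep_mul_simple_single_self, geomRep_mul_simple_apply,
        CoxeterMatrix.simpleCoroot_single_of_eq_three hm, neg_one_smul, sub_neg_eq_add,
        neg_add_cancel_comm_assoc]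
      refine ih _ (by omega) u t (fun hd' => ?_) rfl
      rw [isRightDescent_iff] at hd'
      have hb : u * cs.simple s * cs.simple t * cs.simple s =
          u * cs.simple t * (cs.simple s * cs.simple t) := by
        have := cs.simple_braid hm
        simp only [mul_assoc] at this ⊢
        rw [this]
      rw [hb] at h
      have h1 := cs.length_mul_le (u * cs.simple t) (cs.simple s * cs.simple t)
      have h2 := cs.length_mul_le (cs.simple s) (cs.simple t)
      rw [length_simple, length_simple] at h2
      omega
    · refine add_nonneg (ih _ (by omega) v s hd rfl) (ih _ (by omega) v t ?_ rfl)
      rw [not_isRightDescent_iff]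
      omega

/-- The geometric representation is faithful. -/
theorem geomRep_injective : Function.Injective (cs.geomRep hM) := by
  rw [injective_iff_map_eq_one]
  intro w hw
  by_contra hne
  obtain ⟨s, hs⟩ := cs.exists_rightDescent_of_ne_one hne
  rw [isRightDescent_iff_not_isRightDescent_mul] at hs
  -- The element ws sends α_s to a nonnegative vector, yet triviality of w makes that vector -α_s.
  have := cs.geomRep_single_nonneg hM _ s hs s
  rw [geomRep_mul_simple_single_self, hw] at this
  simp at this

end CoxeterSystem

/-! ### Duality with the Vogan representation modulo 2 -/

namespace CoxeterSystem

variable {S : Type*} [Fintype S] [DecidableEq S] {M : CoxeterMatrix S} {W : Type*} [Group W]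
  (cs : CoxeterSystem M W) (hM : M.IsSimplyLaced)

theorem flipMatrix_mulVec (G : SimpleGraph S) [DecidableRel G.Adj] (s : S) (y : S → ZMod 2) :
    (flipMatrix G s).mulVec y = fun u => y u + if G.Adj u s then y s else 0 := by
  ext u
  simp [flipMatrix_eq, flipNilp, Matrix.add_mulVec, Matrix.vecMulVec_mulVec]

/-- Mod 2 the diagonal 2 of the Cartan matrix vanishes, so ⟨x, α_s⟩ is the sum of x over the
neighbours of s. The reflection changes the pairing by that sum times y_s, and so does the move; the
two changes cancel. -/
theorem simpleReflection_pairing_flipMatrix (s : S) (x : S → ℤ)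
    (y : S → ZMod 2) :
    ∑ u, (M.simpleReflection s x u : ZMod 2) * (flipMatrix M.coxeterGraph s).mulVec y u =
      ∑ u, (x u : ZMod 2) * y u := by
  have hadj (u : S) : M.coxeterGraph.Adj u s ↔ M s u = 3 := by
    rw [M.symmetric s u]
    exact Iff.rfl
  have hc : (M.simpleCoroot s x : ZMod 2) =
      ∑ u, if M.coxeterGraph.Adj u s then (x u : ZMod 2) else 0 := by
    rw [CoxeterMatrix.simpleCoroot_apply, Int.cast_sum]
    refine Finset.sum_congr rfl fun u _ => ?_
    simp only [hadj]
    by_cases hus : u = s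
    · subst hus
      simp [CharTwo.two_eq_zero]
    · by_cases h3 : M s u = 3 <;> simp [hus, h3]
  have : ∀ u, (M.simpleReflection s x u : ZMod 2) * (flipMatrix M.coxeterGraph s).mulVec y u =
      (x u : ZMod 2) * y u + (if M.coxeterGraph.Adj u s then (x u : ZMod 2) else 0) * y s
        - if u = s then (M.simpleCoroot s x : ZMod 2) * y s else 0 := by
    intro u
    rw [flipMatrix_mulVec, CoxeterMatrix.simpleReflection_apply]
    by_cases hus : u = s
    · subst hus
      simp [sub_mul]
    · by_cases h3 : M.coxeterGraph.Adj u s <;> simp [hus, h3, mul_add]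
  simp_rw [this]
  rw [Finset.sum_sub_distrib, Finset.sum_add_distrib, ← Finset.sum_mul, ← hc]
  simp

/-- Modulo two, the Vogan representation is contragredient to the geometric representation. -/
theorem geomRep_pairing_voganRep (w : W) (x : S → ℤ) (y : S → ZMod 2) :
    ∑ u, (cs.geomRep hM w x u : ZMod 2) * (voganRep cs hM w).val.mulVec y u =
      ∑ u, (x u : ZMod 2) * y u := by
  induction w using cs.simple_induction_left generalizing x y with
  | one => simp
  | mul_simple_left w s ih =>
    rw [map_mul, map_mul, geomRep_simple, voganRep_simple, Units.val_mul, ← Matrix.mulVec_mulVec,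
      Module.End.mul_apply]
    exact (simpleReflection_pairing_flipMatrix s _ _).trans (ih x y)

/-- An element lies in the kernel of the Vogan representation exactly when it acts trivially on
the root lattice modulo two. -/
theorem mem_ker_voganRep_iff (w : W) :
    w ∈ (voganRep cs hM).ker ↔ ∀ x u, (cs.geomRep hM w x u : ZMod 2) = x u := by
  constructor
  · intro hw x u
    have := cs.geomRep_pairing_voganRep hM w x (Pi.single u 1)
    rw [MonoidHom.mem_ker.mp hw] at this
    simpa [Matrix.one_apply, Pi.single_apply] using this
  · intro h
    refine MonoidHom.mem_ker.mpr (Units.ext (Matrix.toLin'.injective (LinearMap.ext fun y =>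
      funext fun u => ?_)))
    have := cs.geomRep_pairing_voganRep hM w (Pi.single u 1) y
    simp_rw [h] at this
    simpa [Pi.single_apply] using this

end CoxeterSystem

/-! ### The positive definite form of `E₈` -/

namespace CoxeterMatrix

theorem isSimplyLaced_E₈ : E₈.IsSimplyLaced := by
  intro s t
  fin_cases s <;> fin_cases t <;> simp [E₈]

/-- Half of the quadratic form of the `E₈` root lattice. -/
def formE₈ (x : Fin 8 → ℤ) : ℤ :=
  x 0 ^ 2 + x 1 ^ 2 + x 2 ^ 2 + x 3 ^ 2 + x 4 ^ 2 + x 5 ^ 2 + x 6 ^ 2 + x 7 ^ 2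
    - x 0 * x 2 - x 1 * x 3 - x 2 * x 3 - x 3 * x 4 - x 4 * x 5 - x 5 * x 6 - x 6 * x 7

/-- Completing squares from the ends of the three arms towards the branch vertex 3 leaves the
coefficient 1 - 1/4 - 1/3 - 2/5 = 1/60 on its square; 120 clears denominators. -/
theorem formE₈_identity (x : Fin 8 → ℤ) : 120 * formE₈ x =
    30 * (2 * x 1 - x 3) ^ 2 + 30 * (2 * x 0 - x 2) ^ 2 + 10 * (3 * x 2 - 2 * x 3) ^ 2
      + 30 * (2 * x 7 - x 6) ^ 2 + 10 * (3 * x 6 - 2 * x 5) ^ 2 + 5 * (4 * x 5 - 3 * x 4) ^ 2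
      + 3 * (5 * x 4 - 4 * x 3) ^ 2 + 2 * x 3 ^ 2 := by
  unfold formE₈
  ring

theorem formE₈_nonneg (x : Fin 8 → ℤ) : 0 ≤ formE₈ x := by
  have := formE₈_identity x
  have : 0 ≤ 120 * formE₈ x := by rw [this]; positivity
  omega

theorem eq_zero_of_formE₈_eq_zero {x : Fin 8 → ℤ} (h : formE₈ x = 0) : x = 0 := by
  have hi := formE₈_identity x
  rw [h] at hi
  have h1 := sq_nonneg (2 * x 1 - x 3)
  have h2 := sq_nonneg (2 * x 0 - x 2)
  have h3 := sq_nonneg (3 * x 2 - 2 * x 3)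
  have h4 := sq_nonneg (2 * x 7 - x 6)
  have h5 := sq_nonneg (3 * x 6 - 2 * x 5)
  have h6 := sq_nonneg (4 * x 5 - 3 * x 4)
  have h7 := sq_nonneg (5 * x 4 - 4 * x 3)
  have h8 := sq_nonneg (x 3)
  have e1 := pow_eq_zero_iff two_ne_zero |>.mp (show (2 * x 1 - x 3) ^ 2 = 0 by omega)
  have e2 := pow_eq_zero_iff two_ne_zero |>.mp (show (2 * x 0 - x 2) ^ 2 = 0 by omega)
  have e3 := pow_eq_zero_iff two_ne_zero |>.mp (show (3 * x 2 - 2 * x 3) ^ 2 = 0 by omega)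
  have e4 := pow_eq_zero_iff two_ne_zero |>.mp (show (2 * x 7 - x 6) ^ 2 = 0 by omega)
  have e5 := pow_eq_zero_iff two_ne_zero |>.mp (show (3 * x 6 - 2 * x 5) ^ 2 = 0 by omega)
  have e6 := pow_eq_zero_iff two_ne_zero |>.mp (show (4 * x 5 - 3 * x 4) ^ 2 = 0 by omega)
  have e7 := pow_eq_zero_iff two_ne_zero |>.mp (show (5 * x 4 - 4 * x 3) ^ 2 = 0 by omega)
  have e8 := pow_eq_zero_iff two_ne_zero |>.mp (show (x 3) ^ 2 = 0 by omega)
  ext i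
  fin_cases i <;> simp <;> omega

theorem simpleReflection_E₈_apply (a b c d e f g h : ℤ) (i : Fin 8) :
    E₈.simpleReflection i ![a, b, c, d, e, f, g, h] =
      ![![-a + c, b, c, d, e, f, g, h], ![a, -b + d, c, d, e, f, g, h],
        ![a, b, -c + a + d, d, e, f, g, h], ![a, b, c, -d + b + c + e, e, f, g, h],
        ![a, b, c, d, -e + d + f, f, g, h], ![a, b, c, d, e, -f + e + g, g, h],
        ![a, b, c, d, e, f, -g + f + h, h], ![a, b, c, d, e, f, g, -h + g]] i := by
  rw [simpleReflection_apply, simpleCoroot_apply, Fin.sum_univ_eight]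
  fin_cases i <;> ext j <;> fin_cases j <;> simp [E₈] <;> ring

theorem formE₈_simpleReflection (i : Fin 8) (x : Fin 8 → ℤ) :
    formE₈ (E₈.simpleReflection i x) = formE₈ x := by
  have hx : x = ![x 0, x 1, x 2, x 3, x 4, x 5, x 6, x 7] := by
    ext j; fin_cases j <;> rfl
  rw [hx, simpleReflection_E₈_apply]
  fin_cases i <;> simp [formE₈] <;> ring

end CoxeterMatrix

/-! ### A Coxeter element whose 15th power is -1 -/

namespace CoxeterMatrix

/-- A Coxeter element of type `E₈`, acting on the root lattice. -/
def coxeterElementE₈ : Module.End ℤ (Fin 8 → ℤ) :=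
  (List.ofFn E₈.simpleReflection).prod

theorem coxeterElementE₈_apply (a b c d e f g h : ℤ) :
    coxeterElementE₈ ![a, b, c, d, e, f, g, h] =
      ![b - h, c - h, a + b - h, b + c - h,
        d - h, e - h, f - h, g - h] := by
  simp only [coxeterElementE₈, List.ofFn_succ, List.ofFn_zero, List.prod_cons, List.prod_nil,
    mul_one, Module.End.mul_apply]
  simp only [Fin.reduceSucc, Fin.succ_zero_eq_one, Fin.succ_one_eq_two, simpleReflection_E₈_apply,
    Matrix.cons_val]
  ext i
  fin_cases i <;> simp <;> ring

theorem coxeterElementE₈_pow_five_apply (a b c d e f g h : ℤ) :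
    (coxeterElementE₈ ^ 5) ![a, b, c, d, e, f, g, h] =
      ![a + b + c - d - g, a + 2 * b + c - d - f - h,
        a + 2 * b + 2 * c - d - e - g - h, 2 * a + 3 * b + 2 * c - d - e - f - g - h,
        a + 2 * b + 2 * c - d - f - g - h, a + 2 * b + c - d - g - h, a + b + c - d - h, b + c - d] := by
  simp only [pow_succ, pow_zero, one_mul, Module.End.mul_apply, coxeterElementE₈_apply]
  ext i
  fin_cases i <;> simp <;> ring

/-- The Coxeter number is 30 and all exponents of `E₈` are odd, so half a period acts as -1. The
check composes the explicit fifth power three times. -/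
theorem coxeterElementE₈_pow_fifteen : coxeterElementE₈ ^ 15 = -1 := by
  refine LinearMap.ext fun x => ?_
  have hx : x = ![x 0, x 1, x 2, x 3, x 4, x 5, x 6, x 7] := by
    ext j; fin_cases j <;> rfl
  rw [show 15 = 5 + 5 + 5 from rfl, pow_add, pow_add, Module.End.mul_apply, Module.End.mul_apply,
    hx]
  simp only [coxeterElementE₈_pow_five_apply]
  ext i
  fin_cases i <;> simp <;> ring

end CoxeterMatrix

/-! ### Elements preserving each simple root up to sign -/

namespace CoxeterSystem

open CoxeterMatrix

variable {W : Type*} [Group W] (cs : CoxeterSystem E₈ W)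

theorem formE₈_geomRep (w : W) (x : Fin 8 → ℤ) :
    formE₈ (cs.geomRep isSimplyLaced_E₈ w x) = formE₈ x := by
  induction w using cs.simple_induction_left with
  | one => simp
  | mul_simple_left w s ih =>
    rw [map_mul, geomRep_simple, Module.End.mul_apply, formE₈_simpleReflection, ih]

theorem formE₈_single (s : Fin 8) : formE₈ (Pi.single s 1) = 1 := by
  fin_cases s <;> simp [formE₈]

theorem formE₈_single_add (s t : Fin 8) (h : E₈ s t = 3) :
    formE₈ (Pi.single s 1 + Pi.single t 1) = 1 := by
  fin_cases s <;> fin_cases t <;> first | (simp [E₈] at h; done) | simp [formE₈]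

theorem formE₈_parallelogram (x y : Fin 8 → ℤ) :
    formE₈ (x + y) + formE₈ (x - y) = 2 * formE₈ x + 2 * formE₈ y := by
  simp only [formE₈, Pi.add_apply, Pi.sub_apply]
  ring

theorem formE₈_two_smul (x : Fin 8 → ℤ) : formE₈ ((2 : ℤ) • x) = 4 * formE₈ x := by
  simp only [formE₈, Pi.smul_apply, smul_eq_mul]
  ring

/-- Opposite signs on adjacent roots would give q(α_s - α_t) = q(α_s + α_t) = 1, but the
parallelogram law makes these values sum to 4. -/
theorem geomRep_single_of_adj {w : W} {s t : Fin 8} (h : E₈ s t = 3)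
    (hs : cs.geomRep isSimplyLaced_E₈ w (Pi.single s 1) = Pi.single s 1)
    (ht : cs.geomRep isSimplyLaced_E₈ w (Pi.single t 1) = Pi.single t 1 ∨
      cs.geomRep isSimplyLaced_E₈ w (Pi.single t 1) = -Pi.single t 1) :
    cs.geomRep isSimplyLaced_E₈ w (Pi.single t 1) = Pi.single t 1 := by
  refine ht.resolve_right fun ht => ?_
  have h1 := cs.formE₈_geomRep w (Pi.single s 1 + Pi.single t 1)
  have h2 := formE₈_parallelogram (Pi.single s 1) (Pi.single t 1)
  rw [map_add, hs, ht, ← sub_eq_add_neg] at h1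
  rw [h1, formE₈_single_add s t h, formE₈_single, formE₈_single] at h2
  omega

theorem geomRep_eq_one_of_single_zero {w : W}
    (h : ∀ s, cs.geomRep isSimplyLaced_E₈ w (Pi.single s 1) = Pi.single s 1 ∨
      cs.geomRep isSimplyLaced_E₈ w (Pi.single s 1) = -Pi.single s 1)
    (h0 : cs.geomRep isSimplyLaced_E₈ w (Pi.single 0 1) = Pi.single 0 1) : w = 1 := by
  have h2 := cs.geomRep_single_of_adj (s := 0) (t := 2) (by simp [E₈]) h0 (h 2)
  have h3 := cs.geomRep_single_of_adj (s := 2) (t := 3) (by simp [E₈]) h2 (h 3)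
  have h1 := cs.geomRep_single_of_adj (s := 3) (t := 1) (by simp [E₈]) h3 (h 1)
  have h4 := cs.geomRep_single_of_adj (s := 3) (t := 4) (by simp [E₈]) h3 (h 4)
  have h5 := cs.geomRep_single_of_adj (s := 4) (t := 5) (by simp [E₈]) h4 (h 5)
  have h6 := cs.geomRep_single_of_adj (s := 5) (t := 6) (by simp [E₈]) h5 (h 6)
  have h7 := cs.geomRep_single_of_adj (s := 6) (t := 7) (by simp [E₈]) h6 (h 7)
  refine cs.geomRep_injective isSimplyLaced_E₈ ((Pi.basisFun ℤ (Fin 8)).ext fun i => ?_)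
  rw [map_one, Pi.basisFun_apply, Module.End.one_apply]
  fin_cases i <;> assumption

/-- With x = α_s and wx = x + 2z, the parallelogram law gives q(z) + q(x + z) = 1. Both are
nonnegative integers, so one vanishes, and definiteness gives z = 0 or z = -x. -/
theorem geomRep_single_of_mod_two {w : W}
    (h : ∀ x u, (cs.geomRep isSimplyLaced_E₈ w x u : ZMod 2) = x u) (s : Fin 8) :
    cs.geomRep isSimplyLaced_E₈ w (Pi.single s 1) = Pi.single s 1 ∨
      cs.geomRep isSimplyLaced_E₈ w (Pi.single s 1) = -Pi.single s 1 := by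
  set x : Fin 8 → ℤ := Pi.single s 1 with hx
  set y := cs.geomRep isSimplyLaced_E₈ w x with hy
  have hdvd (u : Fin 8) : (2 : ℤ) ∣ y u - x u := by
    have := h x u
    rw [← hy, ← sub_eq_zero, ← Int.cast_sub] at this
    exact (ZMod.intCast_zmod_eq_zero_iff_dvd _ 2).mp this
  choose z hz using hdvd
  have hyz : y = x + (2 : ℤ) • z := by
    ext u
    have := hz u
    simp only [Pi.add_apply, Pi.smul_apply, smul_eq_mul]
    omega
  have hqy : formE₈ y = 1 := by rw [hy, formE₈_geomRep, hx, formE₈_single]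
  have hp := formE₈_parallelogram y x
  rw [show y + x = (2 : ℤ) • (x + z) by rw [hyz]; module,
    show y - x = (2 : ℤ) • z by rw [hyz]; module, formE₈_two_smul, formE₈_two_smul, hqy,
    hx, formE₈_single, ← hx] at hp
  have h1 := formE₈_nonneg z
  have h2 := formE₈_nonneg (x + z)
  by_cases hz0 : formE₈ z = 0
  · left
    rw [hyz, eq_zero_of_formE₈_eq_zero hz0, smul_zero, add_zero]
  · right
    have hxz := eq_zero_of_formE₈_eq_zero (show formE₈ (x + z) = 0 by omega)
    rw [hyz, eq_neg_of_add_eq_zero_right hxz]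
    module

theorem geomRep_single_of_commute {w : W} {s : Fin 8} (h : w * cs.simple s = cs.simple s * w) :
    cs.geomRep isSimplyLaced_E₈ w (Pi.single s 1) = Pi.single s 1 ∨
      cs.geomRep isSimplyLaced_E₈ w (Pi.single s 1) = -Pi.single s 1 := by
  have h1 := cs.geomRep_mul_simple_single_self isSimplyLaced_E₈ w s
  rw [h, map_mul, Module.End.mul_apply, geomRep_simple, simpleReflection_apply] at h1
  have hq := cs.formE₈_geomRep w (Pi.single s 1)
  set y := cs.geomRep isSimplyLaced_E₈ w (Pi.single s 1)
  -- Commutation makes s negate y; s alters only the coordinate at s, so all others vanish.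
  obtain ⟨k, hk⟩ : ∃ k : ℤ, y = Pi.single s k := by
    refine ⟨y s, funext fun u => ?_⟩
    by_cases hu : u = s
    · simp [hu]
    · have := congrFun h1 u
      simp [hu] at this ⊢
      omega
  rw [formE₈_single, hk] at hq
  have hk2 : k ^ 2 = 1 := by
    rw [← hq]
    fin_cases s <;> simp [formE₈]
  rw [hk]
  rw [pow_two] at hk2
  rcases mul_self_eq_one_iff.mp hk2 with rfl | rfl
  · exact Or.inl rfl
  · exact Or.inr (Pi.single_neg s 1)

/-- The longest element of a Coxeter group of type `E₈`. -/
def longestE₈ : W := (List.ofFn cs.simple).prod ^ 15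

theorem geomRep_longestE₈ : cs.geomRep isSimplyLaced_E₈ cs.longestE₈ = -1 := by
  rw [longestE₈, map_pow, map_list_prod, List.map_ofFn, ← coxeterElementE₈_pow_fifteen,
    coxeterElementE₈]
  congr 4
  exact funext (cs.geomRep_simple isSimplyLaced_E₈)

theorem longestE₈_ne_one : cs.longestE₈ ≠ 1 := by
  intro h
  have h1 := cs.geomRep_longestE₈
  rw [h, map_one] at h1
  have := congrFun (LinearMap.congr_fun h1 (Pi.single 0 1)) 0
  simp at this

theorem eq_one_or_eq_longestE₈ {w : W}
    (h : ∀ s, cs.geomRep isSimplyLaced_E₈ w (Pi.single s 1) = Pi.single s 1 ∨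
      cs.geomRep isSimplyLaced_E₈ w (Pi.single s 1) = -Pi.single s 1) :
    w = 1 ∨ w = cs.longestE₈ := by
  rcases h 0 with h0 | h0
  · exact Or.inl (cs.geomRep_eq_one_of_single_zero h h0)
  · right
    -- Multiplying by the element acting as -1 flips every sign, reducing to the case where α_0 is
    -- fixed.
    have hneg (x : Fin 8 → ℤ) : cs.geomRep isSimplyLaced_E₈ (w * cs.longestE₈) x =
        -cs.geomRep isSimplyLaced_E₈ w x := by
      rw [map_mul, geomRep_longestE₈, mul_neg_one, LinearMap.neg_apply]
    have hll : cs.longestE₈ * cs.longestE₈ = 1 :=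
      cs.geomRep_injective isSimplyLaced_E₈ (by
        rw [map_mul, geomRep_longestE₈, map_one, neg_mul_neg, one_mul])
    have h1 := cs.geomRep_eq_one_of_single_zero (w := w * cs.longestE₈)
      (fun s => by rw [hneg, neg_inj, neg_eq_iff_eq_neg]; exact (h s).symm)
      (by rw [hneg, h0, neg_neg])
    rw [← mul_one w, ← hll, ← mul_assoc, h1, one_mul]

theorem center_eq_pair : (Subgroup.center W : Set W) = {1, cs.longestE₈} := by
  ext w
  rw [SetLike.mem_coe, Subgroup.mem_center_iff, Set.mem_insert_iff, Set.mem_singleton_iff]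
  constructor
  · exact fun h => cs.eq_one_or_eq_longestE₈ fun s => cs.geomRep_single_of_commute (h _).symm
  · rintro (rfl | rfl) g
    · simp
    · refine cs.geomRep_injective isSimplyLaced_E₈ ?_
      rw [map_mul, map_mul, geomRep_longestE₈, mul_neg_one, neg_one_mul]

theorem mod_two_iff (w : W) :
    (∀ x u, (cs.geomRep isSimplyLaced_E₈ w x u : ZMod 2) = x u) ↔ w = 1 ∨ w = cs.longestE₈ := by
  refine ⟨fun h => cs.eq_one_or_eq_longestE₈ (cs.geomRep_single_of_mod_two h), ?_⟩
  rintro (rfl | rfl) x u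
  · simp
  · rw [geomRep_longestE₈]
    simp [CharTwo.neg_eq]

end CoxeterSystem

/-! ### Transfer to an arbitrary labelling of the diagram -/

theorem CoxeterMatrix.IsTypeE8.exists_reindex_eq {S : Type*} {M : CoxeterMatrix S}
    (hM : M.IsTypeE8) : ∃ e : S ≃ Fin 8, M.reindex e = CoxeterMatrix.E₈ := by
  obtain ⟨hs, ⟨f⟩⟩ := hM
  refine ⟨f.toEquiv, CoxeterMatrix.ext (Matrix.ext fun i j => ?_)⟩
  obtain ⟨s, rfl⟩ := f.surjective i
  obtain ⟨t, rfl⟩ := f.surjective j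
  change M (f.symm (f s)) (f.symm (f t)) = CoxeterMatrix.E₈ (f s) (f t)
  rw [f.symm_apply_apply, f.symm_apply_apply]
  have hadj : CoxeterMatrix.E₈ (f s) (f t) = 3 ↔ M s t = 3 := f.map_adj_iff
  by_cases hst : s = t
  · subst hst
    rw [M.diagonal, CoxeterMatrix.diagonal]
  · rcases hs s t hst with h | h
    · have := CoxeterMatrix.isSimplyLaced_E₈ _ _ (f.injective.ne hst)
      omega
    · rw [h, hadj.mpr h]

/-- The kernel of the Vogan representation does not depend on the labelling of the generators. -/
theorem mem_ker_voganRep_reindex {S T : Type*} [Fintype S] [DecidableEq S] [Fintype T]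
    [DecidableEq T] {M : CoxeterMatrix S} {N : CoxeterMatrix T} {W : Type*} [Group W]
    (cs : CoxeterSystem M W) (cs' : CoxeterSystem N W) (hM : M.IsSimplyLaced)
    (hN : N.IsSimplyLaced) (e : S ≃ T) (he : M.reindex e = N)
    (hcs : ∀ s, cs'.simple (e s) = cs.simple s) :
    (voganRep cs hM).ker = (voganRep cs' hN).ker := by
  -- The two representations differ by the isomorphism of general linear groups that relabels rows
  -- and columns along `e`.
  have key : (Units.mapEquiv
      (Matrix.reindexAlgEquiv (ZMod 2) (ZMod 2) e).toMulEquiv).toMonoidHom.comp (voganRep cs hM) =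
      voganRep cs' hN := by
    refine cs.ext_simple fun s => Units.ext (Matrix.ext fun u v => ?_)
    obtain ⟨u, rfl⟩ := e.surjective u
    obtain ⟨v, rfl⟩ := e.surjective v
    rw [MonoidHom.comp_apply, ← hcs, voganRep_simple, hcs, voganRep_simple]
    subst he
    change flipMatrix M.coxeterGraph s (e.symm (e u)) (e.symm (e v)) =
      flipMatrix (M.reindex e).coxeterGraph (e s) (e u) (e v)
    have hadj : (M.reindex e).coxeterGraph.Adj (e u) (e v) ↔ M.coxeterGraph.Adj u v := by
      change M (e.symm (e u)) (e.symm (e v)) = 3 ↔ M u v = 3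
      simp
    simp [flipMatrix, hadj]
  rw [← key]
  exact (MonoidHom.ker_mulEquiv_comp (voganRep cs hM)
    (Units.mapEquiv (Matrix.reindexAlgEquiv (ZMod 2) (ZMod 2) e).toMulEquiv)).symm

theorem ker_voganRep_E₈ {W : Type*} [Group W] (cs : CoxeterSystem CoxeterMatrix.E₈ W) :
    ((voganRep cs CoxeterMatrix.isSimplyLaced_E₈).ker : Set W) = {1, cs.longestE₈} := by
  ext w
  rw [SetLike.mem_coe, CoxeterSystem.mem_ker_voganRep_iff, CoxeterSystem.mod_two_iff]
  rfl

theorem mainTheorem7 {S : Type*} [Fintype S] [DecidableEq S] (M : CoxeterMatrix S)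
    (hM : M.IsTypeE8) {W : Type*} [Group W] (cs : CoxeterSystem M W) :
    Nat.card (voganRep cs hM.1).ker = 2 ∧ (voganRep cs hM.1).ker = Subgroup.center W := by
  obtain ⟨e, he⟩ := hM.exists_reindex_eq
  obtain ⟨cs', hcs'⟩ : ∃ cs' : CoxeterSystem CoxeterMatrix.E₈ W,
      ∀ s, cs'.simple (e s) = cs.simple s := by
    rw [← he]
    exact ⟨cs.reindex e, fun s => by rw [CoxeterSystem.reindex_simple, e.symm_apply_apply]⟩
  rw [mem_ker_voganRep_reindex cs cs' hM.1 CoxeterMatrix.isSimplyLaced_E₈ e he hcs']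
  have hker := ker_voganRep_E₈ cs'
  refine ⟨?_, SetLike.coe_injective (hker.trans cs'.center_eq_pair.symm)⟩
  rw [← SetLike.coe_sort_coe, hker, Nat.card_coe_set_eq,
    Set.ncard_pair cs'.longestE₈_ne_one.symm]
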